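/- Let $K$ be a division ring, $S$ a ring endomorphism of $K$, and $D$ an $S$-derivation of $K$, i.e. an additive endomorphism with $D(ab)=S(a)D(b)+D(a)b$ for all $a,b\in K$. Let $R=K[t,S,D]$ be the Ore skew polynomial ring of left polynomials $\sum b_it^i$ with $tb=S(b)t+D(b)$ for $b\in K$. For $a\in K$ put $N_0(a)=1$, $N_{i+1}(a)=S(N_i(a))a+D(N_i(a))$, and $f(a)=\sum_i b_iN_i(a)$ for $f=\sum_i b_it^i\in R$. For $c\in K^*$ let $a^c=S(c)ac^{-1}+D(c)c^{-1}$; the set $\{a^c:c\in K^*\}$ is the $(S,D)$-conjugacy class of $a$. More generally, $S$ and $D$ act on matrices entrywise, and the $(S,D)$-conjugate of a square matrix $A$ over $K$ by an invertible matrix $P$ is $S(P)AP^{-1}+D(P)P^{-1}$. The Vandermonde matrix $V(c_1,\dots,c_n)$ is the $n\times n$ matrix with $(i+1)$-st row $(N_i(c_1),\dots,N_i(c_n))$, $0\le i<n$. For $a\in K$, the $(S,D)$-centralizer $\{0\}\cup\{c\in K^*:a^c=a\}$ is a division subring of $K$, and for $f\in R$ the exponential space $E(f,a)=\{0\}\cup\{x\in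 K^*:f(a^x)=0\}$ is a right vector space over it. **Theorem 3.5.** Let $f=t^n+b_{n-1}t^{n-1}+\cdots+b_0\in R$ with $n\ge 0$. Then the $(S,D)$-conjugacy classes of $K$ in which $f$ has a root (an $a$ with $f(a)=0$) are finite in number. Let $a_1,\dots,a_r$ be representatives of these classes, one for each, and let $C_j$ be the $(S,D)$-centralizer of $a_j$. The following are equivalent: 1. $f$ is a product $(t-c_1)\cdots(t-c_n)$ of linear factors with $c_i\in K$, and $R/Rf$ is a semisimple left $R$-module. 2. The companion matrix $C(f)$, i.e. the $n\times n$ matrix with ones on the superdiagonal, last row $(-b_0,-b_1,\dots,-b_{n-1})$, and zeros elsewhere, is $(S,D)$-conjugate to a diagonal matrix. 3. There are $c_1,\dots,c_n\in K$ such that $V=V(c_1,\dots,c_n)$ is invertible and $C(f)V=S(V)\,\mathrm{diag}(c_1,\dots,c_n)+D(V)$. 4. $\deg f=\sum_{j=1}^r\dim_{C_j}E(f,a_j)$, the dimensions being those of right vector spaces over $C_j$. -/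

import Mathlib

universe u

/-- An `S`-derivation of a ring `K`, for a ring endomorphism `S`: an additive endomorphism `D`
with `D (a b) = S a * D b + D a * b`. -/
structure SkewDerivation {K : Type u} [Ring K] (S : K →+* K) extends K →+ K where
  leibniz' : ∀ a b : K, toFun (a * b) = S a * toFun b + toFun a * b

namespace SkewDerivation

variable {K : Type u} [Ring K] {S : K →+* K}

instance : FunLike (SkewDerivation S) K K where
  coe D := D.toFun
  coe_injective D E h := by
    cases D; cases E
    congr
    exact DFunLike.coe_injective h

instance : AddMonoidHomClass (SkewDerivation S) K K where
  map_add D := D.map_add'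
  map_zero D := D.map_zero'

theorem leibniz (D : SkewDerivation S) (a b : K) : D (a * b) = S a * D b + D a * b :=
  D.leibniz' a b

theorem map_one (D : SkewDerivation S) : D 1 = 0 := by
  have h := D.leibniz 1 1
  simpa using h

end SkewDerivation

/-- The Ore skew polynomial ring `K[t, S, D]`: the elements are the left polynomials
`∑ bᵢ tⁱ`, recorded by their coefficients. (The endomorphism `S` is part of the type of `D`.) -/
def OrePolynomial {K : Type u} [Ring K] {S : K →+* K} (_D : SkewDerivation S) : Type u :=
  ℕ →₀ K

namespace OrePolynomial

section Ring

variable {K : Type u} [Ring K] {S : K →+* K} (D : SkewDerivation S)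

noncomputable instance : AddCommGroup (OrePolynomial D) := inferInstanceAs (AddCommGroup (ℕ →₀ K))

noncomputable instance : Module K (OrePolynomial D) := inferInstanceAs (Module K (ℕ →₀ K))

/-- The monomial `b tⁱ`. -/
noncomputable def monomial (i : ℕ) : K →+ OrePolynomial D := Finsupp.singleAddHom i

variable {D}

/-- The coefficient of `tⁱ`. -/
def coeff (f : OrePolynomial D) (i : ℕ) : K := (show ℕ →₀ K from f) i

theorem addHom_ext {M : Type*} [AddZeroClass M] {g h : OrePolynomial D →+ M}
    (H : ∀ i b, g (monomial D i b) = h (monomial D i b)) : g = h :=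
  Finsupp.addHom_ext H

variable (D)

/-- Left multiplication by `t`: the additive map with `b tⁱ ↦ S b tⁱ⁺¹ + D b tⁱ`. -/
noncomputable def tMul : AddMonoid.End (OrePolynomial D) :=
  Finsupp.liftAddHom fun i =>
    (monomial D (i + 1)).comp S.toAddMonoidHom + (monomial D i).comp D.toAddMonoidHom

theorem tMul_monomial (i : ℕ) (b : K) :
    tMul D (monomial D i b) = monomial D (i + 1) (S b) + monomial D i (D b) :=
  Finsupp.liftAddHom_apply_single _ _ _

/-- The left action of `f = ∑ bᵢ tⁱ`, namely `∑ bᵢ (tMul)ⁱ`. -/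
noncomputable def leftMul : OrePolynomial D →+ AddMonoid.End (OrePolynomial D) :=
  Finsupp.liftAddHom fun i =>
    (AddMonoidHom.mulRight (tMul D ^ i)).comp
      (Module.toAddMonoidEnd K (OrePolynomial D)).toAddMonoidHom

theorem leftMul_add (f g h : OrePolynomial D) :
    leftMul D (f + g) h = leftMul D f h + leftMul D g h := by
  rw [map_add]
  rfl

theorem tMul_pow_succ (i : ℕ) (g : OrePolynomial D) :
    (tMul D ^ (i + 1)) g = tMul D ((tMul D ^ i) g) := by
  rw [pow_succ']
  rfl

theorem leftMul_monomial (i : ℕ) (b : K) (g : OrePolynomial D) :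
    leftMul D (monomial D i b) g = b • (tMul D ^ i) g := by
  have h : leftMul D (monomial D i b) = _ := Finsupp.liftAddHom_apply_single _ _ _
  rw [h]
  rfl

theorem smul_monomial (c : K) (i : ℕ) (b : K) : c • monomial D i b = monomial D i (c * b) :=
  Finsupp.smul_single _ _ _

theorem tMul_smul (c : K) (g : OrePolynomial D) :
    tMul D (c • g) = S c • tMul D g + D c • g := by
  let A : OrePolynomial D →+ OrePolynomial D :=
    AddMonoidHom.comp (tMul D) (DistribSMul.toAddMonoidHom _ c)
  let B : OrePolynomial D →+ OrePolynomial D :=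
    AddMonoidHom.comp (DistribSMul.toAddMonoidHom _ (S c)) (tMul D) +
      DistribSMul.toAddMonoidHom _ (D c)
  have h : A = B := by
    refine addHom_ext fun i b => ?_
    change tMul D (c • monomial D i b) = S c • tMul D (monomial D i b) + D c • monomial D i b
    simp only [smul_monomial, tMul_monomial, smul_add, map_mul, SkewDerivation.leibniz, map_add]
    abel
  exact DFunLike.congr_fun h g

theorem tMul_pow_one (i : ℕ) : (tMul D ^ i) (monomial D 0 1) = monomial D i 1 := by
  induction i with
  | zero => rfl
  | succ i ih =>
    rw [tMul_pow_succ, ih, tMul_monomial, map_one, SkewDerivation.map_one,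
      map_zero, add_zero]

theorem leftMul_smul (c : K) (f g : OrePolynomial D) :
    leftMul D (c • f) g = c • leftMul D f g := by
  let A : OrePolynomial D →+ OrePolynomial D :=
    ((leftMul D).flip g).comp (Module.toAddMonoidEnd K (OrePolynomial D) c)
  let B : OrePolynomial D →+ OrePolynomial D :=
    AddMonoidHom.comp (Module.toAddMonoidEnd K (OrePolynomial D) c) ((leftMul D).flip g)
  have h : A = B := by
    refine addHom_ext fun i b => ?_
    change leftMul D (c • monomial D i b) g = c • leftMul D (monomial D i b) g
    rw [smul_monomial, leftMul_monomial, leftMul_monomial, mul_smul]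
  exact DFunLike.congr_fun h f

theorem leftMul_tMul (f g : OrePolynomial D) :
    leftMul D (tMul D f) g = tMul D (leftMul D f g) := by
  let A : OrePolynomial D →+ OrePolynomial D := ((leftMul D).flip g).comp (tMul D)
  let B : OrePolynomial D →+ OrePolynomial D :=
    AddMonoidHom.comp (tMul D) ((leftMul D).flip g)
  have h : A = B := by
    refine addHom_ext fun i b => ?_
    change leftMul D (tMul D (monomial D i b)) g = tMul D (leftMul D (monomial D i b) g)
    rw [tMul_monomial, leftMul_add, leftMul_monomial, leftMul_monomial,
      leftMul_monomial, tMul_smul, tMul_pow_succ]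
  exact DFunLike.congr_fun h f

theorem leftMul_leftMul (f g h : OrePolynomial D) :
    leftMul D (leftMul D f g) h = leftMul D f (leftMul D g h) := by
  let A : OrePolynomial D →+ OrePolynomial D :=
    ((leftMul D).flip h).comp ((leftMul D).flip g)
  let B : OrePolynomial D →+ OrePolynomial D := (leftMul D).flip (leftMul D g h)
  have key : A = B := by
    refine addHom_ext fun i b => ?_
    change leftMul D (leftMul D (monomial D i b) g) h = leftMul D (monomial D i b) (leftMul D g h)
    rw [leftMul_monomial, leftMul_monomial, leftMul_smul]
    congr 1
    induction i with
    | zero => rfl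
    | succ i ih =>
      rw [tMul_pow_succ, tMul_pow_succ, leftMul_tMul, ih]
  exact DFunLike.congr_fun key f

theorem leftMul_one_right (f : OrePolynomial D) : leftMul D f (monomial D 0 1) = f := by
  let A : OrePolynomial D →+ OrePolynomial D := (leftMul D).flip (monomial D 0 1)
  have h : A = AddMonoidHom.id _ := by
    refine addHom_ext fun i b => ?_
    change leftMul D (monomial D i b) (monomial D 0 1) = monomial D i b
    rw [leftMul_monomial, tMul_pow_one, smul_monomial, mul_one]
  exact DFunLike.congr_fun h f

/-- The ring structure of `K[t, S, D]`: coefficientwise addition, and the multiplication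
determined by `t b = S b t + D b`. -/
noncomputable instance : Ring (OrePolynomial D) :=
  { (inferInstance : AddCommGroup (OrePolynomial D)) with
    mul := fun f g => leftMul D f g
    one := monomial D 0 1
    left_distrib := fun f g h => map_add (leftMul D f) g h
    right_distrib := fun f g h => leftMul_add D f g h
    zero_mul := fun f => by
      change leftMul D 0 f = 0
      rw [map_zero]
      rfl
    mul_zero := fun f => map_zero (leftMul D f)
    mul_assoc := fun f g h => leftMul_leftMul D f g h
    one_mul := fun f => by
      change leftMul D (monomial D 0 1) f = f
      rw [leftMul_monomial, one_smul]
      rfl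
    mul_one := fun f => leftMul_one_right D f }

theorem mul_def (f g : OrePolynomial D) : f * g = leftMul D f g := rfl

/-- The indeterminate `t`. -/
noncomputable def t : OrePolynomial D := monomial D 1 1

/-- The embedding of `K` in `K[t, S, D]` as the ring of constants. -/
noncomputable def C : K →+* OrePolynomial D :=
  { monomial D 0 with
    map_one' := rfl
    map_mul' := fun a b => by
      change monomial D 0 (a * b) = leftMul D (monomial D 0 a) (monomial D 0 b)
      rw [leftMul_monomial, ← smul_monomial]
      rfl }

/-- The defining commutation rule `t b = S b t + D b`. -/
theorem t_mul_C (b : K) : t D * C D b = C D (S b) * t D + C D (D b) := by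
  change leftMul D (monomial D 1 1) (monomial D 0 b) =
    leftMul D (monomial D 0 (S b)) (monomial D 1 1) + monomial D 0 (D b)
  rw [leftMul_monomial, leftMul_monomial, one_smul, pow_one, tMul_monomial, pow_zero,
    AddMonoid.End.one_apply, smul_monomial, mul_one]

/-- The monomial `b tⁱ` is the product of `b` and `tⁱ` in the ring `K[t, S, D]`. -/
theorem monomial_eq (i : ℕ) (b : K) : monomial D i b = C D b * t D ^ i := by
  have ht : t D ^ i = monomial D i 1 := by
    induction i with
    | zero => rfl
    | succ i ih =>
      rw [pow_succ', ih, mul_def, t, leftMul_monomial, one_smul, pow_one, tMul_monomial, map_one,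
        SkewDerivation.map_one, map_zero, add_zero]
  rw [ht]
  change _ = leftMul D (monomial D 0 b) (monomial D i 1)
  rw [leftMul_monomial, pow_zero, AddMonoid.End.one_apply, smul_monomial, mul_one]

variable {D}

/-- The degree of `f`, with value `0` for `f = 0`. -/
def natDegree (f : OrePolynomial D) : ℕ := (show ℕ →₀ K from f).support.sup id

/-- `f` is monic: its leading coefficient is `1`. -/
def Monic (f : OrePolynomial D) : Prop := f.coeff f.natDegree = 1

/-- `f` is a product `(t - c₁) ⋯ (t - cₘ)` of linear factors. -/
def Splits (f : OrePolynomial D) : Prop :=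
  ∃ l : List K, f = (l.map fun c => t D - C D c).prod

variable (D)

/-- The power functions: `N₀(a) = 1` and `Nᵢ₊₁(a) = S(Nᵢ(a)) a + D(Nᵢ(a))`. -/
def powerFn : ℕ → K → K
  | 0, _ => 1
  | i + 1, a => S (powerFn i a) * a + D (powerFn i a)

variable {D}

/-- The value `f(a) = ∑ bᵢ Nᵢ(a)` of `f = ∑ bᵢ tⁱ` at `a`. -/
def eval (f : OrePolynomial D) (a : K) : K :=
  (show ℕ →₀ K from f).sum fun i b => b * powerFn D i a

/-- The companion matrix of a monic `f = tⁿ + bₙ₋₁ tⁿ⁻¹ + ⋯ + b₀`: ones on the superdiagonal,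
last row `-b₀, …, -bₙ₋₁`, and zeros elsewhere. -/
def companion (f : OrePolynomial D) : Matrix (Fin f.natDegree) (Fin f.natDegree) K :=
  Matrix.of fun i j =>
    if (i : ℕ) + 1 = f.natDegree then -f.coeff j else if (j : ℕ) = i + 1 then 1 else 0

variable (D)

/-- The `n × n` Vandermonde matrix `V(c₁, …, cₙ)`: its rows are
`(Nᵢ(c₁), …, Nᵢ(cₙ))` for `i = 0, …, n - 1`. -/
def vandermonde {n : ℕ} (c : Fin n → K) : Matrix (Fin n) (Fin n) K :=
  Matrix.of fun i j => powerFn D i (c j)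

/-- The `(S, D)`-conjugate `S(P) A P⁻¹ + D(P) P⁻¹` of a square matrix `A` by an invertible
matrix `P`; here `S` and `D` act on matrices entrywise. -/
def matrixConj {n : ℕ} (A : Matrix (Fin n) (Fin n) K) (P : (Matrix (Fin n) (Fin n) K)ˣ) :
    Matrix (Fin n) (Fin n) K :=
  (P : Matrix (Fin n) (Fin n) K).map S * A * (↑P⁻¹ : Matrix (Fin n) (Fin n) K) +
    (P : Matrix (Fin n) (Fin n) K).map D * (↑P⁻¹ : Matrix (Fin n) (Fin n) K)

end Ring

section DivisionRing

variable {K : Type u} [DivisionRing K] {S : K →+* K} (D : SkewDerivation S)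

/-- The `(S, D)`-conjugate `a^c = S(c) a c⁻¹ + D(c) c⁻¹` of `a` by `c` (meant for `c ≠ 0`). -/
def conj (a c : K) : K := S c * a * c⁻¹ + D c * c⁻¹

/-- The `(S, D)`-conjugacy class `{a^c : c ≠ 0}` of `a`. -/
def conjClass (a : K) : Set K := {b | ∃ c : K, c ≠ 0 ∧ b = conj D a c}

theorem conj_mul_self (a : K) {c : K} (hc : c ≠ 0) : conj D a c * c = S c * a + D c := by
  simp [conj, add_mul, mul_assoc, hc]

theorem conj_eq_self_iff (a : K) {c : K} (hc : c ≠ 0) :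
    conj D a c = a ↔ S c * a + D c = a * c := by
  rw [← conj_mul_self D a hc]
  exact (mul_left_inj' hc).symm

theorem mem_centralizer_iff (a c : K) :
    (c = 0 ∨ c ≠ 0 ∧ conj D a c = a) ↔ S c * a + D c = a * c := by
  by_cases hc : c = 0
  · simp [hc]
  · simp [hc, conj_eq_self_iff]

/-- The `(S, D)`-centralizer `{0} ∪ {c ≠ 0 : a^c = a}` of `a`, a division subring of `K`. -/
def centralizer (a : K) : Subfield K where
  carrier := {c | c = 0 ∨ c ≠ 0 ∧ conj D a c = a}
  zero_mem' := Or.inl rfl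
  one_mem' := (mem_centralizer_iff D a 1).2 (by simp [SkewDerivation.map_one])
  add_mem' := by
    intro x y hx hy
    have hx' := (mem_centralizer_iff D a x).1 hx
    have hy' := (mem_centralizer_iff D a y).1 hy
    refine (mem_centralizer_iff D a _).2 ?_
    rw [map_add, map_add, mul_add, ← hx', ← hy', add_mul]
    abel
  neg_mem' := by
    intro x hx
    have hx' := (mem_centralizer_iff D a x).1 hx
    refine (mem_centralizer_iff D a _).2 ?_
    rw [map_neg, map_neg, mul_neg, ← hx', neg_mul]
    abel
  mul_mem' := by
    intro x y hx hy
    have hx' := (mem_centralizer_iff D a x).1 hx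
    have hy' := (mem_centralizer_iff D a y).1 hy
    refine (mem_centralizer_iff D a _).2 ?_
    rw [map_mul, SkewDerivation.leibniz, ← mul_assoc a, ← hx', add_mul, mul_assoc (S x) a y, ← hy']
    noncomm_ring
  inv_mem' := by
    intro x hx
    by_cases h0 : x = 0
    · simp [h0]
    have hx' := (mem_centralizer_iff D a x).1 hx
    refine (mem_centralizer_iff D a _).2 ?_
    have hS : S x ≠ 0 := (map_ne_zero S).2 h0
    apply mul_left_cancel₀ hS
    have h1 : S x * S x⁻¹ = 1 := by rw [← map_mul, mul_inv_cancel₀ h0, _root_.map_one]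
    have h2 : S x * D x⁻¹ + D x * x⁻¹ = 0 := by
      rw [← SkewDerivation.leibniz, mul_inv_cancel₀ h0, SkewDerivation.map_one]
    have h3 : S x * a * x⁻¹ + D x * x⁻¹ = a := by
      rw [← add_mul, hx', mul_inv_cancel_right₀ h0]
    rw [mul_add, ← mul_assoc, h1, one_mul, eq_neg_of_add_eq_zero_left h2, ← mul_assoc]
    nth_rewrite 1 [← h3]
    abel

/-- `K` as a right vector space over the division subring `centralizer D a`. -/
instance rightModule (a : K) : Module (centralizer D a)ᵐᵒᵖ K :=
  Module.compHom K (centralizer D a).subtype.op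

theorem op_smul_def (a : K) (c : (centralizer D a)ᵐᵒᵖ) (x : K) :
    c • x = x * (c.unop : K) := rfl

variable {D}

/-- The pseudo-linear map `x ↦ S(x) a + D(x)`. -/
def pseudo (D : SkewDerivation S) (a : K) : K →+ K :=
  (AddMonoidHom.mulRight a).comp S.toAddMonoidHom + D.toAddMonoidHom

theorem pseudo_apply (a x : K) : pseudo D a x = S x * a + D x := rfl

theorem powerFn_conj_mul (a : K) {x : K} (hx : x ≠ 0) (i : ℕ) :
    powerFn D i (conj D a x) * x = (pseudo D a)^[i] x := by
  induction i with
  | zero => simp [powerFn]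
  | succ i ih =>
    rw [Function.iterate_succ_apply', ← ih, pseudo_apply, powerFn, add_mul, mul_assoc,
      conj_mul_self D a hx, map_mul, SkewDerivation.leibniz]
    noncomm_ring

/-- The additive map `x ↦ ∑ bᵢ Tⁱ(x)`, for `T = pseudo D a` and `f = ∑ bᵢ tⁱ`. -/
def action (f : OrePolynomial D) (a x : K) : K :=
  (show ℕ →₀ K from f).sum fun i b => b * (pseudo D a)^[i] x

theorem eval_conj_mul (f : OrePolynomial D) (a : K) {x : K} (hx : x ≠ 0) :
    eval f (conj D a x) * x = action f a x := by
  unfold eval action Finsupp.sum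
  rw [Finset.sum_mul]
  exact Finset.sum_congr rfl fun i _ => by rw [mul_assoc, powerFn_conj_mul a hx]

theorem iterate_pseudo_mul (a x : K) {c : K} (hc : S c * a + D c = a * c) (i : ℕ) :
    (pseudo D a)^[i] (x * c) = (pseudo D a)^[i] x * c := by
  induction i with
  | zero => rfl
  | succ i ih =>
    rw [Function.iterate_succ_apply', ih, Function.iterate_succ_apply', pseudo_apply, pseudo_apply,
      map_mul, SkewDerivation.leibniz, mul_assoc, add_mul, mul_assoc (S _) a c, ← hc]
    noncomm_ring

theorem mem_expSpace_iff (f : OrePolynomial D) (a x : K) :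
    (x = 0 ∨ x ≠ 0 ∧ eval f (conj D a x) = 0) ↔ action f a x = 0 := by
  by_cases hx : x = 0
  · simp [hx, action, Finsupp.sum, iterate_map_zero]
  · simp [hx, ← eval_conj_mul f a hx]

/-- The exponential space `E(f, a) = {0} ∪ {x ≠ 0 : f(a^x) = 0}`, a right vector space over
the `(S, D)`-centralizer of `a`. -/
def expSpace (f : OrePolynomial D) (a : K) : Submodule (centralizer D a)ᵐᵒᵖ K where
  carrier := {x | x = 0 ∨ x ≠ 0 ∧ eval f (conj D a x) = 0}
  zero_mem' := Or.inl rfl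
  add_mem' := by
    intro x y hx hy
    have hx' := (mem_expSpace_iff f a x).1 hx
    have hy' := (mem_expSpace_iff f a y).1 hy
    refine (mem_expSpace_iff f a _).2 ?_
    have h : action f a (x + y) = action f a x + action f a y := by
      simp [action, Finsupp.sum, iterate_map_add, mul_add, Finset.sum_add_distrib]
    rw [h, hx', hy', add_zero]
  smul_mem' := by
    intro c x hx
    have hx' := (mem_expSpace_iff f a x).1 hx
    have hc := (mem_centralizer_iff D a _).1 c.unop.2
    refine (mem_expSpace_iff f a _).2 ?_
    have h : action f a (x * (c.unop : K)) = action f a x * (c.unop : K) := by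
      simp [action, Finsupp.sum, iterate_pseudo_mul a x hc, Finset.sum_mul, mul_assoc]
    rw [op_smul_def, h, hx', zero_mul]

/-- `a₁, …, aᵣ` are representatives, one for each, of the `(S, D)`-conjugacy classes in which
`f` has a root. -/
structure IsRootClassReps (f : OrePolynomial D) {r : ℕ} (a : Fin r → K) : Prop where
  exists_root : ∀ j, ∃ x ∈ conjClass D (a j), eval f x = 0
  not_conj : ∀ i j, i ≠ j → a i ∉ conjClass D (a j)
  covers : ∀ x, eval f x = 0 → ∃ j, x ∈ conjClass D (a j)

end DivisionRing

end OrePolynomial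

namespace OrePolynomial

variable {K : Type u} [DivisionRing K] {S : K →+* K} {D : SkewDerivation S}

/-! ### Coefficients and left multiplication by `t` -/

theorem ext {f g : OrePolynomial D} (h : ∀ i, f.coeff i = g.coeff i) : f = g :=
  Finsupp.ext h

@[simp] theorem coeff_zero (i : ℕ) : (0 : OrePolynomial D).coeff i = 0 := rfl

@[simp] theorem coeff_add (f g : OrePolynomial D) (i : ℕ) :
    (f + g).coeff i = f.coeff i + g.coeff i := rfl

@[simp] theorem coeff_sub (f g : OrePolynomial D) (i : ℕ) :
    (f - g).coeff i = f.coeff i - g.coeff i := rfl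

@[simp] theorem coeff_smul (c : K) (f : OrePolynomial D) (i : ℕ) :
    (c • f).coeff i = c * f.coeff i := rfl

theorem coeff_monomial (i j : ℕ) (b : K) :
    (monomial D i b).coeff j = if i = j then b else 0 :=
  Finsupp.single_apply

theorem C_mul (c : K) (f : OrePolynomial D) : C D c * f = c • f := by
  change leftMul D (monomial D 0 c) f = _
  rw [leftMul_monomial]
  rfl

theorem t_mul (f : OrePolynomial D) : t D * f = tMul D f := by
  change leftMul D (monomial D 1 1) f = _
  rw [leftMul_monomial, one_smul, pow_one]

theorem monomial_mul (i : ℕ) (b : K) (f : OrePolynomial D) :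
    monomial D i b * f = b • (tMul D ^ i) f :=
  leftMul_monomial D i b f

theorem coeff_tMul_succ (f : OrePolynomial D) (j : ℕ) :
    (tMul D f).coeff (j + 1) = S (f.coeff j) + D (f.coeff (j + 1)) := by
  let A : OrePolynomial D →+ K := (Finsupp.applyAddHom (j + 1)).comp (tMul D)
  let B : OrePolynomial D →+ K := S.toAddMonoidHom.comp (Finsupp.applyAddHom j) +
    D.toAddMonoidHom.comp (Finsupp.applyAddHom (j + 1))
  have h : A = B := by
    refine addHom_ext fun i b => ?_
    change (tMul D (monomial D i b)).coeff (j + 1) =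
      S ((monomial D i b).coeff j) + D ((monomial D i b).coeff (j + 1))
    rw [tMul_monomial, coeff_add, coeff_monomial, coeff_monomial, coeff_monomial, coeff_monomial]
    by_cases h1 : i = j <;> by_cases h2 : i = j + 1 <;> simp [h1, h2]
  exact DFunLike.congr_fun h f

/-! ### The module structures on `K` -/

/-- The action of a skew polynomial at `a` on `x`, as an additive map of the polynomial. -/
noncomputable def actionHom (D : SkewDerivation S) (a x : K) : OrePolynomial D →+ K :=
  Finsupp.liftAddHom fun i => AddMonoidHom.mulRight ((pseudo D a)^[i] x)

theorem action_add_left (f g : OrePolynomial D) (a x : K) :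
    action (f + g) a x = action f a x + action g a x :=
  map_add (actionHom D a x) f g

theorem action_sub_left (f g : OrePolynomial D) (a x : K) :
    action (f - g) a x = action f a x - action g a x :=
  map_sub (actionHom D a x) f g

theorem action_sum_left {ι : Type*} (s : Finset ι) (f : ι → OrePolynomial D) (a x : K) :
    action (∑ l ∈ s, f l) a x = ∑ l ∈ s, action (f l) a x :=
  map_sum (actionHom D a x) f s

theorem action_monomial (i : ℕ) (b a x : K) :
    action (monomial D i b) a x = b * (pseudo D a)^[i] x :=
  Finsupp.sum_single_index (zero_mul _)

theorem action_smul (c : K) (f : OrePolynomial D) (a x : K) :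
    action (c • f) a x = c * action f a x := by
  let A : OrePolynomial D →+ K := (actionHom D a x).comp (DistribSMul.toAddMonoidHom _ c)
  let B : OrePolynomial D →+ K := (AddMonoidHom.mulLeft c).comp (actionHom D a x)
  have h : A = B := by
    refine addHom_ext fun i b => ?_
    change action (c • monomial D i b) a x = c * action (monomial D i b) a x
    rw [smul_monomial, action_monomial, action_monomial, mul_assoc]
  exact DFunLike.congr_fun h f

theorem action_C (c a x : K) : action (C D c) a x = c * x :=
  action_monomial 0 c a x

theorem action_tMul (f : OrePolynomial D) (a x : K) :
    action (tMul D f) a x = S (action f a x) * a + D (action f a x) := by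
  let A : OrePolynomial D →+ K := (actionHom D a x).comp (tMul D)
  let B : OrePolynomial D →+ K := (pseudo D a).comp (actionHom D a x)
  have h : A = B := by
    refine addHom_ext fun i b => ?_
    change action (tMul D (monomial D i b)) a x = pseudo D a (action (monomial D i b) a x)
    rw [tMul_monomial, action_add_left, action_monomial, action_monomial, action_monomial,
      Function.iterate_succ_apply', pseudo_apply, pseudo_apply, map_mul, SkewDerivation.leibniz]
    noncomm_ring
  exact DFunLike.congr_fun h f

/-- The module axiom for `K_a`; on monomials it reduces to `t` acting as `pseudo D a`. -/
theorem action_mul (f g : OrePolynomial D) (a x : K) :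
    action (f * g) a x = action f a (action g a x) := by
  let A : OrePolynomial D →+ K := (actionHom D a x).comp (AddMonoidHom.mulRight g)
  let B : OrePolynomial D →+ K := actionHom D a (action g a x)
  have h : A = B := by
    refine addHom_ext fun i b => ?_
    change action (monomial D i b * g) a x = action (monomial D i b) a (action g a x)
    rw [monomial_mul, action_smul, action_monomial]
    congr 1
    induction i with
    | zero => rfl
    | succ i ih =>
      rw [tMul_pow_succ, action_tMul, ih, Function.iterate_succ_apply', pseudo_apply]
  exact DFunLike.congr_fun h f

theorem action_zero_right (f : OrePolynomial D) (a : K) : action f a 0 = 0 :=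
  (mem_expSpace_iff f a 0).1 (Or.inl rfl)

theorem conj_one (a : K) : conj D a 1 = a := by
  simp [conj, SkewDerivation.map_one]

theorem eval_eq_action (f : OrePolynomial D) (a : K) : eval f a = action f a 1 := by
  simpa [conj_one] using eval_conj_mul f a (one_ne_zero (α := K))

theorem powerFn_eq_iterate (a : K) (i : ℕ) : powerFn D i a = (pseudo D a)^[i] 1 := by
  simpa [conj_one] using powerFn_conj_mul (D := D) a (one_ne_zero (α := K)) i

theorem eval_conj_eq_zero_iff (f : OrePolynomial D) (a : K) {x : K} (hx : x ≠ 0) :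
    eval f (conj D a x) = 0 ↔ action f a x = 0 := by
  rw [← eval_conj_mul f a hx]
  simp [hx]

theorem mem_expSpace (f : OrePolynomial D) (a x : K) :
    x ∈ expSpace f a ↔ action f a x = 0 :=
  mem_expSpace_iff f a x

theorem mem_centralizer (a c : K) : c ∈ centralizer D a ↔ S c * a + D c = a * c :=
  mem_centralizer_iff D a c

theorem action_of_coeff_eq_zero {n : ℕ} (f : OrePolynomial D) (hf : ∀ i, n ≤ i → f.coeff i = 0)
    (a x : K) : action f a x = ∑ i : Fin n, f.coeff i * (pseudo D a)^[i] x := by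
  rw [← Finset.sum_range (fun i => f.coeff i * (pseudo D a)^[i] x)]
  refine Finsupp.sum_of_support_subset _ (fun i hi => ?_) _ (by simp)
  rw [Finset.mem_range]
  by_contra h
  exact (Finsupp.mem_support_iff.1 hi) (hf i (not_lt.1 h))

theorem self_mem_conjClass (a : K) : a ∈ conjClass D a :=
  ⟨1, one_ne_zero, (conj_one a).symm⟩

theorem conjClass_symm {a b : K} (h : b ∈ conjClass D a) : a ∈ conjClass D b := by
  obtain ⟨c, hc, rfl⟩ := h
  refine ⟨c⁻¹, inv_ne_zero hc, ?_⟩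
  have h1 : S c⁻¹ * S c = 1 := by rw [← map_mul, inv_mul_cancel₀ hc, map_one]
  have h2 : S c⁻¹ * D c + D c⁻¹ * c = 0 := by
    rw [← SkewDerivation.leibniz, inv_mul_cancel₀ hc, SkewDerivation.map_one]
  symm
  rw [conj, conj, inv_inv, mul_assoc, add_mul, inv_mul_cancel_right₀ hc,
    inv_mul_cancel_right₀ hc, mul_add, ← mul_assoc, h1, one_mul, add_assoc, h2, add_zero]

/-! ### Independent families and density -/

/-- A family of vectors `x k`, each in `K` with the pseudo-linear map of `a k`, is independent
if no `x k` is a combination of finitely many others with intertwining coefficients. -/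
def ActionIndependent (D : SkewDerivation S) {ι : Type*} (a x : ι → K) : Prop :=
  ∀ (k : ι) (s : Finset ι), k ∉ s → ∀ c : ι → K,
    (∀ l ∈ s, S (c l) * a k + D (c l) = a l * c l) → x k ≠ ∑ l ∈ s, x l * c l

theorem ActionIndependent.exists_dual {ι : Type*} [DecidableEq ι] {a x : ι → K}
    (h : ActionIndependent D a x) (s : Finset ι) :
    ∃ g : ι → OrePolynomial D, ∀ l ∈ s, ∀ k ∈ s,
      action (g l) (a k) (x k) = if l = k then 1 else 0 := by
  induction s using Finset.induction_on with
  | empty => exact ⟨0, by simp⟩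
  | insert k s hk ih =>
    obtain ⟨g, hg⟩ := ih
    have key : ∃ p : OrePolynomial D,
        (∀ l ∈ s, action p (a l) (x l) = 0) ∧ action p (a k) (x k) ≠ 0 := by
      -- Otherwise whatever kills all `x l` also kills `x k`. Subtracting from `m` its expansion in
      -- the duals then shows that `m` acts on `x k` through its values on the `x l`, with fixed
      -- right coefficients `c l`.
      by_contra! hp
      let c : ι → K := fun l => action (g l) (a k) (x k)
      have hm (m : OrePolynomial D) :
          action m (a k) (x k) = ∑ l ∈ s, action m (a l) (x l) * c l := by
        have := hp (m - ∑ l ∈ s, action m (a l) (x l) • g l) fun j hj => by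
          rw [action_sub_left, action_sum_left, sub_eq_zero]
          rw [Finset.sum_eq_single j]
          · rw [action_smul, hg j hj j hj, if_pos rfl, mul_one]
          · intro l hl hlj
            rw [action_smul, hg l hl j hj, if_neg hlj, mul_zero]
          · exact fun h => absurd hj h
        rw [action_sub_left, action_sum_left, sub_eq_zero] at this
        simpa only [action_smul] using this
      -- Taking `m = t g_j` shows that `c j` intertwines; taking `m = 1` gives the forbidden
      -- relation.
      refine h k s hk c (fun j hj => ?_) ?_
      · have h1 := hm (tMul D (g j))
        rw [action_tMul, Finset.sum_eq_single j] at h1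
        · rw [h1, action_tMul, hg j hj j hj]
          simp [SkewDerivation.map_one]
        · intro l hl hlj
          rw [action_tMul, hg j hj l hl, if_neg (Ne.symm hlj)]
          simp
        · exact fun h => absurd hj h
      · have h1 := hm 1
        rw [← map_one (C D)] at h1
        simpa only [action_C, one_mul] using h1
    obtain ⟨p, hp, hpk⟩ := key
    let q := (action p (a k) (x k))⁻¹ • p
    have hq : ∀ l ∈ s, action q (a l) (x l) = 0 := fun l hl => by
      rw [action_smul, hp l hl, mul_zero]
    have hqk : action q (a k) (x k) = 1 := by rw [action_smul, inv_mul_cancel₀ hpk]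
    -- The old duals are corrected by multiples of `q` so as to vanish at `x k`.
    refine ⟨fun l => if l = k then q else g l - action (g l) (a k) (x k) • q, ?_⟩
    intro l hl j hj
    rcases Finset.mem_insert.1 hl with rfl | hl
    · rcases Finset.mem_insert.1 hj with rfl | hj
      · simpa using hqk
      · have : l ≠ j := fun h => hk (h ▸ hj)
        simpa [this] using hq j hj
    · have hlk : l ≠ k := fun h => hk (h ▸ hl)
      rcases Finset.mem_insert.1 hj with rfl | hj
      · simp [hlk, action_sub_left, action_smul, hqk]
      · simp [hlk, action_sub_left, action_smul, hq j hj, hg l hl j hj]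

/-! ### Monic polynomials and division -/

/-- `f` is monic of degree `n`. -/
def IsMonicOfDegree (f : OrePolynomial D) (n : ℕ) : Prop :=
  f.coeff n = 1 ∧ ∀ i, n < i → f.coeff i = 0

theorem coeff_eq_zero_of_natDegree_lt (f : OrePolynomial D) {i : ℕ} (hi : f.natDegree < i) :
    f.coeff i = 0 := by
  by_contra h
  exact absurd (Finset.le_sup (f := id) (Finsupp.mem_support_iff.2 h)) (not_le.2 hi)

theorem Monic.isMonicOfDegree {f : OrePolynomial D} (hf : f.Monic) :
    IsMonicOfDegree f f.natDegree :=
  ⟨hf, fun _ => coeff_eq_zero_of_natDegree_lt f⟩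

theorem IsMonicOfDegree.tMul {f : OrePolynomial D} {n : ℕ} (hf : IsMonicOfDegree f n) :
    IsMonicOfDegree (tMul D f) (n + 1) := by
  refine ⟨?_, fun i hi => ?_⟩
  · rw [coeff_tMul_succ, hf.1, hf.2 _ n.lt_succ_self, map_one, map_zero, add_zero]
  · obtain ⟨i, rfl⟩ := Nat.exists_eq_add_of_lt hi
    rw [coeff_tMul_succ, hf.2 _ (by omega), hf.2 _ (by omega), map_zero, map_zero, add_zero]

theorem IsMonicOfDegree.tMul_pow {f : OrePolynomial D} {n : ℕ} (hf : IsMonicOfDegree f n)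
    (i : ℕ) : IsMonicOfDegree ((OrePolynomial.tMul D ^ i) f) (n + i) := by
  induction i with
  | zero => exact hf
  | succ i ih =>
    rw [tMul_pow_succ]
    exact ih.tMul

theorem IsMonicOfDegree.t_sub_C_mul {f : OrePolynomial D} {n : ℕ} (hf : IsMonicOfDegree f n)
    (c : K) : IsMonicOfDegree ((t D - C D c) * f) (n + 1) := by
  rw [sub_mul, t_mul, C_mul]
  refine ⟨?_, fun i hi => ?_⟩
  · rw [coeff_sub, hf.tMul.1, coeff_smul, hf.2 _ n.lt_succ_self, mul_zero, sub_zero]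
  · rw [coeff_sub, hf.tMul.2 _ hi, coeff_smul, hf.2 _ (by omega), mul_zero, sub_zero]

theorem isMonicOfDegree_one : IsMonicOfDegree (1 : OrePolynomial D) 0 := by
  refine ⟨(coeff_monomial 0 0 1).trans (if_pos rfl), fun i hi => ?_⟩
  exact (coeff_monomial 0 i 1).trans (if_neg hi.ne)

theorem isMonicOfDegree_t_sub_C (c : K) : IsMonicOfDegree (t D - C D c) 1 := by
  simpa using (isMonicOfDegree_one (D := D)).t_sub_C_mul c

/-- Division with remainder by a monic skew polynomial. -/
theorem IsMonicOfDegree.exists_div {f : OrePolynomial D} {n : ℕ} (hf : IsMonicOfDegree f n)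
    (g : OrePolynomial D) : ∃ q, ∀ i, n ≤ i → (g - q * f).coeff i = 0 := by
  suffices h : ∀ (N : ℕ) (g : OrePolynomial D), (∀ i, n + N ≤ i → g.coeff i = 0) →
      ∃ q, ∀ i, n ≤ i → (g - q * f).coeff i = 0 from
    h (g.natDegree + 1) g fun i hi => coeff_eq_zero_of_natDegree_lt g (by omega)
  intro N
  induction N with
  | zero => exact fun g hg => ⟨0, by simpa using hg⟩
  | succ N ih =>
    intro g hg
    -- `t^N f` is again monic because `S 1 = 1`, so a left scalar multiple of it cancels the top
    -- coefficient of `g`, even if `S` is not surjective.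
    have hN := hf.tMul_pow N
    obtain ⟨q, hq⟩ := ih (g - monomial D N (g.coeff (n + N)) * f) fun i hi => by
      rw [coeff_sub, monomial_mul, coeff_smul]
      rcases hi.eq_or_lt with rfl | hi
      · rw [hN.1, mul_one, sub_self]
      · rw [hN.2 i hi, hg i (by omega), mul_zero, sub_zero]
    refine ⟨monomial D N (g.coeff (n + N)) + q, fun i hi => ?_⟩
    rw [add_mul, ← sub_sub]
    exact hq i hi

theorem sum_monomial (f : OrePolynomial D) :
    f = ∑ i ∈ Finset.range (f.natDegree + 1), monomial D i (f.coeff i) := by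
  refine (Finsupp.sum_single f).symm.trans
    (Finsupp.sum_of_support_subset _ (fun i hi => ?_) _ (by simp))
  rw [Finset.mem_range]
  by_contra h
  exact Finsupp.mem_support_iff.1 hi (coeff_eq_zero_of_natDegree_lt f (by omega))

theorem coeff_sum {ι : Type*} (s : Finset ι) (f : ι → OrePolynomial D) (i : ℕ) :
    (∑ l ∈ s, f l).coeff i = ∑ l ∈ s, (f l).coeff i :=
  Finsupp.finsetSum_apply _ _ _

theorem coeff_natDegree_ne_zero {f : OrePolynomial D} (hf : f ≠ 0) :
    f.coeff f.natDegree ≠ 0 := by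
  have hne : (show ℕ →₀ K from f).support.Nonempty := Finsupp.support_nonempty_iff.2 hf
  obtain ⟨i, hi, h⟩ := Finset.exists_mem_eq_sup _ hne id
  have : f.natDegree = i := h
  rw [this]
  exact Finsupp.mem_support_iff.1 hi

theorem IsMonicOfDegree.coeff_mul {f : OrePolynomial D} {n : ℕ} (hf : IsMonicOfDegree f n)
    (q : OrePolynomial D) : (q * f).coeff (n + q.natDegree) = q.coeff q.natDegree := by
  have h : q * f = ∑ i ∈ Finset.range (q.natDegree + 1), monomial D i (q.coeff i) * f := by
    rw [← Finset.sum_mul, ← sum_monomial]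
  rw [h, coeff_sum, Finset.sum_range_succ, Finset.sum_eq_zero, zero_add,
    monomial_mul, coeff_smul, (hf.tMul_pow _).1, mul_one]
  intro i hi
  rw [Finset.mem_range] at hi
  rw [monomial_mul, coeff_smul, (hf.tMul_pow i).2 _ (by omega), mul_zero]

theorem IsMonicOfDegree.eq_zero_of_dvd {f g : OrePolynomial D} {n : ℕ}
    (hf : IsMonicOfDegree f n) (hg : ∀ i, n ≤ i → g.coeff i = 0)
    (h : ∃ q, g = q * f) : g = 0 := by
  obtain ⟨q, rfl⟩ := h
  by_contra h0
  have hq : q ≠ 0 := by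
    rintro rfl
    exact h0 (zero_mul f)
  refine coeff_natDegree_ne_zero hq ?_
  rw [← hf.coeff_mul]
  exact hg _ (by omega)

theorem IsMonicOfDegree.eq_of_dvd_of_dvd {f g : OrePolynomial D} {m n : ℕ}
    (hf : IsMonicOfDegree f n) (hg : IsMonicOfDegree g m)
    (h1 : ∃ q, g = q * f) (h2 : ∃ q, f = q * g) : f = g := by
  have hmn : m = n := by
    rcases lt_trichotomy m n with h | h | h
    · have := hf.eq_zero_of_dvd (fun i hi => hg.2 i (by omega)) h1
      exact absurd (hg.1.symm.trans (this ▸ coeff_zero m)) one_ne_zero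
    · exact h
    · have := hg.eq_zero_of_dvd (fun i hi => hf.2 i (by omega)) h2
      exact absurd (hf.1.symm.trans (this ▸ coeff_zero n)) one_ne_zero
  subst hmn
  refine sub_eq_zero.1 (hg.eq_zero_of_dvd (fun i hi => ?_) ?_)
  · rw [coeff_sub]
    rcases hi.eq_or_lt with rfl | hi
    · rw [hf.1, hg.1, sub_self]
    · rw [hf.2 i hi, hg.2 i hi, sub_self]
  · obtain ⟨q, hq⟩ := h2
    exact ⟨q - 1, by rw [sub_mul, one_mul, ← hq]⟩

/-! ### Roots, linear factors and maximal left ideals -/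

theorem action_t_sub_C (c a x : K) :
    action (t D - C D c) a x = S x * a + D x - c * x := by
  rw [action_sub_left, action_C, t, action_monomial, one_mul]
  rfl

/-- The remainder of `g` on division by `t - c` is `g(c)`. -/
theorem exists_eq_mul_add_eval (g : OrePolynomial D) (c : K) :
    ∃ q, g = q * (t D - C D c) + C D (eval g c) := by
  obtain ⟨q, hq⟩ := (isMonicOfDegree_t_sub_C (D := D) c).exists_div g
  -- In `K_c` the vector `1` is killed by `t - c`, so acting on it reads off the constant remainder.
  have h := action_of_coeff_eq_zero _ hq c 1
  rw [action_sub_left, action_mul, action_t_sub_C, map_one, SkewDerivation.map_one, one_mul,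
    mul_one, add_zero, sub_self, action_zero_right, sub_zero, ← eval_eq_action] at h
  simp only [Fin.sum_univ_one, Fin.val_zero, Function.iterate_zero, id, mul_one] at h
  refine ⟨q, ?_⟩
  rw [← sub_eq_iff_eq_add']
  refine ext fun i => ?_
  rw [h]
  change _ = (monomial D 0 _).coeff i
  rw [coeff_monomial]
  split_ifs with hi
  · rw [← hi]
  · exact hq i (by omega)

theorem eval_eq_zero_iff (g : OrePolynomial D) (c : K) :
    eval g c = 0 ↔ ∃ q, g = q * (t D - C D c) := by
  constructor
  · intro h
    obtain ⟨q, hq⟩ := exists_eq_mul_add_eval g c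
    exact ⟨q, by rw [hq, h, map_zero, add_zero]⟩
  · rintro ⟨q, rfl⟩
    rw [eval_eq_action, action_mul, action_t_sub_C, map_one, SkewDerivation.map_one, one_mul,
      mul_one, add_zero, sub_self, action_zero_right]

theorem mem_span_t_sub_C (g : OrePolynomial D) (c : K) :
    g ∈ Submodule.span (OrePolynomial D) {t D - C D c} ↔ eval g c = 0 := by
  rw [eval_eq_zero_iff, Submodule.mem_span_singleton]
  exact exists_congr fun q => eq_comm

theorem one_mem_of_C_mem {I : Submodule (OrePolynomial D) (OrePolynomial D)} {e : K}
    (he : e ≠ 0) (h : C D e ∈ I) : (1 : OrePolynomial D) ∈ I := by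
  have := I.smul_mem (C D e⁻¹) h
  rwa [smul_eq_mul, ← map_mul, inv_mul_cancel₀ he, map_one] at this

theorem eq_top_of_one_mem {I : Submodule (OrePolynomial D) (OrePolynomial D)}
    (h : (1 : OrePolynomial D) ∈ I) : I = ⊤ := by
  rw [eq_top_iff]
  intro g _
  simpa using I.smul_mem g h

/-- Modulo `t - c`, `g` is the constant `g(c)`, which would be a unit in `I` if nonzero. -/
theorem eval_eq_zero_of_mem {I : Submodule (OrePolynomial D) (OrePolynomial D)} (hI : I ≠ ⊤)
    {c : K} (hc : t D - C D c ∈ I) {g : OrePolynomial D} (hg : g ∈ I) : eval g c = 0 := by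
  by_contra h
  obtain ⟨q, hq⟩ := exists_eq_mul_add_eval g c
  refine hI (eq_top_of_one_mem (one_mem_of_C_mem h ?_))
  rw [eq_sub_of_add_eq' hq.symm]
  exact I.sub_mem hg (I.smul_mem q hc)

theorem isCoatom_span_t_sub_C (c : K) :
    IsCoatom (Submodule.span (OrePolynomial D) {t D - C D c}) := by
  refine ⟨fun h => ?_, fun I hI => ?_⟩
  · have h1 : (1 : OrePolynomial D) ∈ Submodule.span (OrePolynomial D) {t D - C D c} :=
      h ▸ Submodule.mem_top
    rw [mem_span_t_sub_C, eval_eq_action, ← map_one (C D), action_C, one_mul] at h1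
    exact one_ne_zero h1
  · by_contra hne
    obtain ⟨g, hg, hgc⟩ := SetLike.exists_of_lt hI
    exact hgc ((mem_span_t_sub_C g c).2
      (eval_eq_zero_of_mem hne (hI.le (Submodule.mem_span_singleton_self _)) hg))

/-- A maximal left ideal that contains a product of linear factors contains a linear factor. -/
theorem exists_t_sub_C_mem {I : Submodule (OrePolynomial D) (OrePolynomial D)}
    (hI : IsCoatom I) (l : List K) (hl : (l.map fun c => t D - C D c).prod ∈ I) :
    ∃ c, t D - C D c ∈ I := by
  induction l with
  | nil => exact absurd (eq_top_of_one_mem (by simpa using hl)) hI.1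
  | cons c₀ l ih =>
    rw [List.map_cons, List.prod_cons] at hl
    set h := (l.map fun c => t D - C D c).prod
    by_cases hh : h ∈ I
    · exact ih hh
    have htop : I ⊔ Submodule.span (OrePolynomial D) {h} = ⊤ := by
      refine hI.2 _ (lt_of_le_of_ne le_sup_left fun he => hh ?_)
      rw [he]
      exact Submodule.mem_sup_right (Submodule.mem_span_singleton_self h)
    obtain ⟨i, hi, y, hy, hiy⟩ :=
      Submodule.mem_sup.1 (htop ▸ Submodule.mem_top : (1 : OrePolynomial D) ∈ _)
    obtain ⟨g, rfl⟩ := Submodule.mem_span_singleton.1 hy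
    obtain ⟨q, hq⟩ := exists_eq_mul_add_eval g c₀
    set e := eval g c₀
    -- Dividing `g` by `t - c₀` turns `1 = i + g h` into `1 ≡ e h` modulo `I`, with `e` a constant.
    have h1 : 1 - C D e * h ∈ I := by
      have : 1 - C D e * h = i + q • ((t D - C D c₀) * h) := by
        rw [← hiy, smul_eq_mul, smul_eq_mul, hq]
        noncomm_ring
      rw [this]
      exact I.add_mem hi (I.smul_mem q hl)
    have he : e ≠ 0 := by
      intro he
      rw [he, map_zero, zero_mul, sub_zero] at h1
      exact hI.1 (eq_top_of_one_mem h1)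
    -- Conjugation by `e` moves the linear factor across it: `(t - c₀^e) e = S(e) (t - c₀)`.
    refine ⟨conj D c₀ e, ?_⟩
    have h2 : (t D - C D (conj D c₀ e)) * C D e = C D (S e) * (t D - C D c₀) := by
      rw [sub_mul, t_mul_C, ← map_mul, conj_mul_self D c₀ he, mul_sub, ← map_mul, map_add]
      abel
    have h3 : t D - C D (conj D c₀ e) = (t D - C D (conj D c₀ e)) • (1 - C D e * h) +
        C D (S e) • ((t D - C D c₀) * h) := by
      rw [smul_eq_mul, smul_eq_mul, mul_sub, mul_one, ← mul_assoc, h2, mul_assoc, sub_add_cancel]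
    rw [h3]
    exact I.add_mem (I.smul_mem _ h1) (I.smul_mem _ hl)

/-- Semisimplicity makes the Jacobson radical of `R/Rf` zero, so it suffices to test membership in
the maximal left ideals over `Rf`, each of which contains some `t - c` because `f` splits. -/
theorem Splits.mem_span_of_eval_eq_zero {f : OrePolynomial D} (hf : f.Splits)
    [IsSemisimpleModule (OrePolynomial D)
      (OrePolynomial D ⧸ Submodule.span (OrePolynomial D) {f})]
    {m : OrePolynomial D} (hm : ∀ c, eval f c = 0 → eval m c = 0) :
    m ∈ Submodule.span (OrePolynomial D) {f} := by
  rw [← Submodule.Quotient.mk_eq_zero, ← Submodule.mem_bot (OrePolynomial D),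
    ← IsSemisimpleModule.jacobson_eq_bot, Module.jacobson, Submodule.mem_sInf]
  intro N hN
  have hI : IsCoatom (N.comap (Submodule.span (OrePolynomial D) {f}).mkQ) := by
    have := isSimpleModule_iff_isCoatom.2 (Set.mem_ofPred.1 hN)
    rw [← N.ker_mkQ, ← LinearMap.ker_comp]
    exact LinearMap.isCoatom_ker_of_surjective
      (N.mkQ_surjective.comp (Submodule.mkQ_surjective _))
  set I := N.comap (Submodule.span (OrePolynomial D) {f}).mkQ
  have hfI : f ∈ I := by
    change Submodule.Quotient.mk f ∈ N
    rw [(Submodule.Quotient.mk_eq_zero _).2 (Submodule.mem_span_singleton_self f)]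
    exact N.zero_mem
  obtain ⟨l, hl⟩ := hf
  obtain ⟨c, hc⟩ := exists_t_sub_C_mem hI l (hl ▸ hfI)
  have := (mem_span_t_sub_C m c).2 (hm c (eval_eq_zero_of_mem hI.1 hc hfI))
  exact (Submodule.span_singleton_le_iff_mem _ _).2 hc this

/-! ### Left ideals of polynomials vanishing at finitely many points -/

/-- If the left ideal of `f` is the set of polynomials vanishing at finitely many given points,
then `R / R f` is semisimple. -/
theorem isSemisimpleModule_of_mem_span_iff {f : OrePolynomial D} {n : ℕ} (c : Fin n → K)
    (h : ∀ g, g ∈ Submodule.span (OrePolynomial D) {f} ↔ ∀ k, eval g (c k) = 0) :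
    IsSemisimpleModule (OrePolynomial D)
      (OrePolynomial D ⧸ Submodule.span (OrePolynomial D) {f}) := by
  have (k : Fin n) : IsSimpleModule (OrePolynomial D)
      (OrePolynomial D ⧸ Submodule.span (OrePolynomial D) {t D - C D (c k)}) :=
    isSimpleModule_iff_isCoatom.2 (isCoatom_span_t_sub_C (c k))
  let φ : OrePolynomial D →ₗ[OrePolynomial D]
      ∀ k, OrePolynomial D ⧸ Submodule.span (OrePolynomial D) {t D - C D (c k)} :=
    LinearMap.pi fun k => Submodule.mkQ _
  have hφ : LinearMap.ker φ = Submodule.span (OrePolynomial D) {f} := by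
    ext g
    rw [h, LinearMap.mem_ker, funext_iff]
    refine forall_congr' fun k => ?_
    rw [← mem_span_t_sub_C]
    exact Submodule.Quotient.mk_eq_zero _
  refine IsSemisimpleModule.of_injective (Submodule.liftQ _ φ hφ.ge) ?_
  rw [← LinearMap.ker_eq_bot]
  exact Submodule.ker_liftQ_eq_bot _ _ _ hφ.le

/-- The polynomials vanishing at finitely many points form the left ideal generated by a product
of linear factors. -/
theorem exists_splits_generator (l : List K) :
    ∃ (g : OrePolynomial D) (m : ℕ), g.Splits ∧ IsMonicOfDegree g m ∧
      ∀ p, (∀ c ∈ l, eval p c = 0) ↔ ∃ q, p = q * g := by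
  induction l with
  | nil => exact ⟨1, 0, ⟨[], rfl⟩, isMonicOfDegree_one, fun p => by simp⟩
  | cons c l ih =>
    obtain ⟨g, m, ⟨l', hl'⟩, hm, hg⟩ := ih
    by_cases hc : eval g c = 0
    · refine ⟨g, m, ⟨l', hl'⟩, hm, fun p => ?_⟩
      rw [← hg, List.forall_mem_cons, and_iff_right_iff_imp]
      intro hp
      obtain ⟨q, rfl⟩ := (hg p).1 hp
      rw [eval_eq_action, action_mul, ← eval_eq_action, hc, action_zero_right]
    · refine ⟨(t D - C D (conj D c (eval g c))) * g, m + 1,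
        ⟨conj D c (eval g c) :: l', by rw [List.map_cons, List.prod_cons, ← hl']⟩,
        hm.t_sub_C_mul _, fun p => ?_⟩
      -- The product formula: `q g` vanishes at `c` exactly when `q` vanishes at `c^(g(c))`, since
      -- `g` sends `1` to `g(c)` in `K_c`.
      have key (q : OrePolynomial D) :
          eval (q * g) c = 0 ↔ ∃ q', q = q' * (t D - C D (conj D c (eval g c))) := by
        rw [← eval_eq_zero_iff, eval_conj_eq_zero_iff q c hc, eval_eq_action (q * g), action_mul,
          ← eval_eq_action g]
      rw [List.forall_mem_cons, hg]
      constructor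
      · rintro ⟨h1, q, rfl⟩
        obtain ⟨q', rfl⟩ := (key q).1 h1
        exact ⟨q', mul_assoc _ _ _⟩
      · rintro ⟨q, rfl⟩
        refine ⟨?_, _, (mul_assoc _ _ _).symm⟩
        rw [← mul_assoc]
        exact (key _).2 ⟨q, rfl⟩

/-- A left ideal has at most one monic generator, so `f` is the split generator already built. -/
theorem IsMonicOfDegree.splits_of_mem_span_iff {f : OrePolynomial D} {n m : ℕ}
    (hf : IsMonicOfDegree f n) (c : Fin m → K)
    (h : ∀ g, g ∈ Submodule.span (OrePolynomial D) {f} ↔ ∀ k, eval g (c k) = 0) : f.Splits := by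
  obtain ⟨g, m, hgs, hm, hg⟩ := exists_splits_generator (D := D) (List.ofFn c)
  have h' (p : OrePolynomial D) : (∃ q, p = q * f) ↔ ∃ q, p = q * g := by
    rw [← hg, List.forall_mem_ofFn_iff, ← h, Submodule.mem_span_singleton]
    exact exists_congr fun q => eq_comm
  rw [hf.eq_of_dvd_of_dvd hm ((h' g).2 ⟨1, (one_mul g).symm⟩) ((h' f).1 ⟨1, (one_mul f).symm⟩)]
  exact hgs

/-! ### The companion matrix and diagonalization -/

theorem companion_mul_apply (f : OrePolynomial D)
    (Q : Matrix (Fin f.natDegree) (Fin f.natDegree) K) (i k : Fin f.natDegree) :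
    (f.companion * Q) i k = if h : (i : ℕ) + 1 < f.natDegree then Q ⟨i + 1, h⟩ k
      else -∑ j : Fin f.natDegree, f.coeff j * Q j k := by
  rw [Matrix.mul_apply]
  simp only [companion, Matrix.of_apply]
  split_ifs with h1 h2 h2
  · omega
  · simp
  · rw [Finset.sum_eq_single ⟨i + 1, h2⟩]
    · simp
    · intro j _ hj
      rw [if_neg, zero_mul]
      exact fun h => hj (Fin.ext h)
    · simp
  · omega

theorem Monic.action_eq {f : OrePolynomial D} (hf : f.Monic) (a x : K) :
    action f a x = ∑ j : Fin f.natDegree, f.coeff j * (pseudo D a)^[j] x +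
      (pseudo D a)^[f.natDegree] x := by
  rw [action_of_coeff_eq_zero (n := f.natDegree + 1) f
    (fun i hi => coeff_eq_zero_of_natDegree_lt f hi), Fin.sum_univ_castSucc]
  simp only [Fin.val_castSucc, Fin.val_last]
  rw [show f.coeff f.natDegree = 1 from hf, one_mul]

/-- A matrix intertwines the companion matrix with `diag(d)` if and only if its columns are the
iterates of the pseudo-linear maps of `d` on elements annihilated by `f`. -/
theorem Monic.companion_mul_eq_iff {f : OrePolynomial D} (hf : f.Monic)
    (Q : Matrix (Fin f.natDegree) (Fin f.natDegree) K) (d : Fin f.natDegree → K) :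
    f.companion * Q = Q.map S * Matrix.diagonal d + Q.map D ↔
      ∀ k, ∃ x, action f (d k) x = 0 ∧ ∀ i, Q i k = (pseudo D (d k))^[i] x := by
  have entry : f.companion * Q = Q.map S * Matrix.diagonal d + Q.map D ↔
      ∀ k i, (f.companion * Q) i k = pseudo D (d k) (Q i k) := by
    rw [← Matrix.ext_iff, forall_comm]
    simp only [Matrix.add_apply, Matrix.mul_diagonal, Matrix.map_apply, pseudo_apply]
  rw [entry]
  refine forall_congr' fun k => ?_
  constructor
  · intro h
    rcases Nat.eq_zero_or_pos f.natDegree with hn | hn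
    · exact ⟨0, action_zero_right _ _, fun i => absurd i.2 (by omega)⟩
    have hQ : ∀ (i : ℕ) (hi : i < f.natDegree),
        Q ⟨i, hi⟩ k = (pseudo D (d k))^[i] (Q ⟨0, hn⟩ k) := by
      intro i
      induction i with
      | zero => exact fun _ => rfl
      | succ i ih =>
        intro hi
        have := h ⟨i, by omega⟩
        rw [companion_mul_apply, dif_pos hi] at this
        rw [this, Function.iterate_succ_apply', ih]
    refine ⟨Q ⟨0, hn⟩ k, ?_, fun i => hQ i i.2⟩
    -- The superdiagonal rows forced the entries to be iterates; the last row says that `f` kills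
    -- the top entry `x`.
    have hl := h ⟨f.natDegree - 1, by omega⟩
    rw [companion_mul_apply, dif_neg (by simp; omega), hQ, ← Function.iterate_succ_apply' (pseudo D (d k)),
      show (f.natDegree - 1).succ = f.natDegree by omega] at hl
    rw [hf.action_eq, ← hl, ← sub_eq_add_neg, sub_eq_zero]
    exact Finset.sum_congr rfl fun j _ => by rw [hQ j j.2]
  · rintro ⟨x, hx, hQ⟩ i
    rw [companion_mul_apply, hQ i, ← Function.iterate_succ_apply' (pseudo D (d k))]
    split_ifs with hi
    · exact hQ _
    · simp only [hQ]
      rw [hf.action_eq] at hx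
      rw [neg_eq_of_add_eq_zero_right hx, show (i : ℕ).succ = f.natDegree by omega]

theorem map_mul_matrix {n : ℕ} (A B : Matrix (Fin n) (Fin n) K) :
    (A * B).map D = A.map S * B.map D + A.map D * B := by
  ext i j
  simp only [Matrix.map_apply, Matrix.mul_apply, Matrix.add_apply, map_sum,
    SkewDerivation.leibniz, Finset.sum_add_distrib]

theorem map_one_matrix (D : SkewDerivation S) {n : ℕ} :
    (1 : Matrix (Fin n) (Fin n) K).map D = 0 := by
  ext i j
  rw [Matrix.map_apply, Matrix.one_apply]
  split_ifs <;> simp [SkewDerivation.map_one]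

/-- Differentiating `P P⁻¹ = 1` trades `D(P) P⁻¹` for `-S(P) D(P⁻¹)`; then `S(P)` cancels. -/
theorem matrixConj_eq_diagonal_iff {n : ℕ} (A : Matrix (Fin n) (Fin n) K)
    (P : (Matrix (Fin n) (Fin n) K)ˣ) (d : Fin n → K) :
    matrixConj D A P = Matrix.diagonal d ↔
      A * (↑P⁻¹ : Matrix (Fin n) (Fin n) K) =
        (↑P⁻¹ : Matrix (Fin n) (Fin n) K).map S * Matrix.diagonal d +
          (↑P⁻¹ : Matrix (Fin n) (Fin n) K).map D := by
  set Q : Matrix (Fin n) (Fin n) K := ↑P⁻¹ with hQ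
  have hQP : Q * P = 1 := P.inv_mul
  have hPQ : (P : Matrix (Fin n) (Fin n) K) * Q = 1 := P.mul_inv
  have hS1 : Q.map S * (P : Matrix (Fin n) (Fin n) K).map S = 1 := by
    rw [← Matrix.map_mul, hQP, Matrix.map_one _ (map_zero S) (map_one S)]
  have hS2 : (P : Matrix (Fin n) (Fin n) K).map S * Q.map S = 1 := by
    rw [← Matrix.map_mul, hPQ, Matrix.map_one _ (map_zero S) (map_one S)]
  have hD : (P : Matrix (Fin n) (Fin n) K).map S * Q.map D +
      (P : Matrix (Fin n) (Fin n) K).map D * Q = 0 := by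
    rw [← map_mul_matrix, hPQ, map_one_matrix]
  have h : matrixConj D A P =
      (P : Matrix (Fin n) (Fin n) K).map S * (A * Q - Q.map D) := by
    rw [matrixConj, mul_sub, ← mul_assoc, sub_eq_add_neg, ← eq_neg_of_add_eq_zero_right hD]
  rw [h, ← sub_eq_iff_eq_add]
  constructor
  · intro h'
    rw [← h', ← mul_assoc, hS1, one_mul]
  · intro h'
    rw [h', ← mul_assoc, hS2, one_mul]

/-! ### Counting independent vectors killed by `f` -/

/-- An intertwining coefficient between non-conjugate elements is zero, and one within a class lies
in the centralizer, so a relation reduces to a single `j`. -/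
theorem actionIndependent_sigma {J : Type*} {κ : J → Type*} {a : J → K}
    (ha : ∀ i j, i ≠ j → a i ∉ conjClass D (a j)) {x : ∀ j, κ j → K}
    (hx : ∀ j, LinearIndependent (centralizer D (a j))ᵐᵒᵖ (x j)) :
    ActionIndependent D (fun p : Σ j, κ j => a p.1) (fun p => x p.1 p.2) := by
  rintro ⟨j, e⟩ s hs c hc h
  refine linearIndependent_iff_notMem_span.1 (hx j) e ?_
  change x j e = _ at h
  rw [h]
  refine Submodule.sum_mem _ ?_
  rintro ⟨j', e'⟩ hl
  have hcl : S (c ⟨j', e'⟩) * a j + D (c ⟨j', e'⟩) = a j' * c ⟨j', e'⟩ := hc _ hl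
  by_cases h0 : c ⟨j', e'⟩ = 0
  · rw [h0, mul_zero]
    exact Submodule.zero_mem _
  obtain rfl : j' = j := by
    by_contra hne
    refine ha j' j hne ⟨c ⟨j', e'⟩, h0, ?_⟩
    rw [← mul_left_inj' h0, conj_mul_self D (a j) h0, hcl]
  have hmem : c ⟨j', e'⟩ ∈ centralizer D (a j') := (mem_centralizer _ _).2 hcl
  refine Submodule.smul_mem _ (MulOpposite.op ⟨c ⟨j', e'⟩, hmem⟩ :
    (centralizer D (a j'))ᵐᵒᵖ) (Submodule.subset_span ⟨e', ⟨Set.mem_univ _, ?_⟩, rfl⟩)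
  rintro rfl
  exact hs hl

/-- The matrix of an independent family of vectors annihilated by `f` has a left inverse. -/
theorem ActionIndependent.exists_left_inverse {f : OrePolynomial D} {n : ℕ}
    (hf : IsMonicOfDegree f n) {ι : Type*} [Fintype ι] [DecidableEq ι] {a x : ι → K}
    (h : ActionIndependent D a x) (h0 : ∀ k, action f (a k) (x k) = 0) :
    ∃ G : Matrix ι (Fin n) K,
      G * (Matrix.of fun (i : Fin n) k => (pseudo D (a k))^[i] (x k)) = 1 := by
  obtain ⟨g, hg⟩ := h.exists_dual Finset.univ
  choose q hq using fun l => hf.exists_div (g l)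
  refine ⟨Matrix.of fun l i => (g l - q l * f).coeff i, ?_⟩
  ext l k
  rw [Matrix.mul_apply]
  simp only [Matrix.of_apply]
  rw [← action_of_coeff_eq_zero _ (hq l), action_sub_left, action_mul, h0, action_zero_right,
    sub_zero, hg l (Finset.mem_univ _) k (Finset.mem_univ _), Matrix.one_apply]

/-- The left inverse makes `v ↦ v Q` a surjection of left `K`-spaces from dimension `n`. -/
theorem ActionIndependent.card_le {f : OrePolynomial D} {n : ℕ}
    (hf : IsMonicOfDegree f n) {ι : Type*} [Fintype ι] {a x : ι → K}
    (h : ActionIndependent D a x) (h0 : ∀ k, action f (a k) (x k) = 0) :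
    Fintype.card ι ≤ n := by
  classical
  obtain ⟨G, hG⟩ := h.exists_left_inverse hf h0
  set Q := Matrix.of fun (i : Fin n) k => (pseudo D (a k))^[i] (x k)
  have hsurj : Function.Surjective Q.vecMulLinear := fun v =>
    ⟨Matrix.vecMul v G, by rw [Matrix.vecMulLinear_apply, Matrix.vecMul_vecMul, hG,
      Matrix.vecMul_one]⟩
  simpa using LinearMap.finrank_le_finrank_of_surjective hsurj

theorem ActionIndependent.comp_injective {ι ι' : Type*} {a x : ι → K}
    (h : ActionIndependent D a x) {e : ι' → ι} (he : Function.Injective e) :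
    ActionIndependent D (a ∘ e) (x ∘ e) := by
  intro k s hk c hc hsum
  refine h (e k) (s.map ⟨e, he⟩) (by simpa [he.eq_iff] using hk)
    (Function.extend e c 0) (fun l hl => ?_) ?_
  · obtain ⟨l, hl', rfl⟩ := Finset.mem_map.1 hl
    change S (Function.extend e c 0 (e l)) * _ + D (Function.extend e c 0 (e l)) =
      _ * Function.extend e c 0 (e l)
    rw [he.extend_apply]
    exact hc l hl'
  · rw [Finset.sum_map]
    simp only [Function.Embedding.coeFn_mk, he.extend_apply]
    exact hsum

theorem ActionIndependent.finite {f : OrePolynomial D} {n : ℕ}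
    (hf : IsMonicOfDegree f n) {ι : Type*} {a x : ι → K}
    (h : ActionIndependent D a x) (h0 : ∀ k, action f (a k) (x k) = 0) : Finite ι := by
  by_contra hι
  rw [not_finite_iff_infinite] at hι
  obtain ⟨s, hs⟩ := Infinite.exists_subset_card_eq ι (n + 1)
  have := (h.comp_injective (e := ((↑) : s → ι)) Subtype.val_injective).card_le hf
    (fun k => h0 k)
  rw [Fintype.card_coe] at this
  omega

/-- Bases of the exponential spaces at pairwise non-conjugate elements combine to a finite
independent family. -/
theorem IsMonicOfDegree.exists_expSpace_bases {f : OrePolynomial D} {n r : ℕ}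
    (hf : IsMonicOfDegree f n) {a : Fin r → K}
    (ha : ∀ i j, i ≠ j → a i ∉ conjClass D (a j)) :
    ∃ (κ : Type u) (_ : Fintype κ) (p : κ → Fin r) (x : κ → K),
      ActionIndependent D (fun k => a (p k)) x ∧
      (∀ k, action f (a (p k)) (x k) = 0) ∧
      ∑ j, Module.rank (centralizer D (a j))ᵐᵒᵖ (expSpace f (a j)) = (Fintype.card κ : Cardinal) ∧
      ∀ m : OrePolynomial D, (∀ k, action m (a (p k)) (x k) = 0) →
        ∀ j, expSpace f (a j) ≤ expSpace m (a j) := by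
  let b := fun j => Module.Basis.ofVectorSpace (centralizer D (a j))ᵐᵒᵖ (expSpace f (a j))
  let κ := Σ j, Module.Basis.ofVectorSpaceIndex (centralizer D (a j))ᵐᵒᵖ (expSpace f (a j))
  let x : κ → K := fun p => b p.1 p.2
  have hind : ActionIndependent D (fun k : κ => a k.1) x :=
    actionIndependent_sigma (x := fun j e => (b j e : K)) ha fun j =>
      (b j).linearIndependent.map' (expSpace f (a j)).subtype (Submodule.ker_subtype _)
  have h0 (k : κ) : action f (a k.1) (x k) = 0 := (mem_expSpace _ _ _).1 (b k.1 k.2).2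
  -- Finite dimensionality of the exponential spaces comes from the bound `n` on finite subfamilies.
  have : Finite κ := hind.finite hf h0
  have (j : Fin r) : Finite
      (Module.Basis.ofVectorSpaceIndex (centralizer D (a j))ᵐᵒᵖ (expSpace f (a j))) :=
    Finite.of_injective (Sigma.mk j : _ → κ) sigma_mk_injective
  have (j : Fin r) := Fintype.ofFinite
    (Module.Basis.ofVectorSpaceIndex (centralizer D (a j))ᵐᵒᵖ (expSpace f (a j)))
  refine ⟨κ, inferInstance, Sigma.fst, x, hind, h0, ?_, fun m hm j => ?_⟩
  · rw [Fintype.card_sigma, Nat.cast_sum]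
    refine Finset.sum_congr rfl fun j _ => ?_
    rw [← (b j).mk_eq_rank'', Cardinal.mk_fintype]
  · have h1 : (⊤ : Submodule (centralizer D (a j))ᵐᵒᵖ (expSpace f (a j))) ≤
        (expSpace m (a j)).comap (expSpace f (a j)).subtype := by
      rw [← (b j).span_eq, Submodule.span_le]
      rintro _ ⟨e, rfl⟩
      exact (mem_expSpace _ _ _).2 (hm ⟨j, e⟩)
    exact fun y hy => h1 (Submodule.mem_top : (⟨y, hy⟩ : expSpace f (a j)) ∈ _)

/-- If no finite list of roots met every class, one could pick `n + 1` pairwise non-conjugate roots;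
the vectors `1` at these would be too many independent vectors killed by `f`. -/
theorem IsMonicOfDegree.exists_isRootClassReps {f : OrePolynomial D} {n : ℕ}
    (hf : IsMonicOfDegree f n) : ∃ (r : ℕ) (a : Fin r → K), f.IsRootClassReps a := by
  by_contra! hne
  have key (r : ℕ) : ∃ a : Fin r → K, (∀ j, eval f (a j) = 0) ∧
      ∀ i j, i ≠ j → a i ∉ conjClass D (a j) := by
    induction r with
    | zero => exact ⟨Fin.elim0, fun j => j.elim0, fun j => j.elim0⟩
    | succ r ih =>
      obtain ⟨a, h1, h2⟩ := ih
      have hcov : ∃ y, eval f y = 0 ∧ ∀ j, y ∉ conjClass D (a j) := by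
        by_contra! hcov
        exact hne r a ⟨fun j => ⟨a j, self_mem_conjClass _, h1 j⟩, h2, hcov⟩
      obtain ⟨y, hy, hya⟩ := hcov
      refine ⟨Fin.cons y a, fun j => ?_, fun i j => ?_⟩
      · refine Fin.cases ?_ (fun j => ?_) j
        · simpa using hy
        · simpa using h1 j
      · refine Fin.cases ?_ (fun i => ?_) i <;> refine Fin.cases ?_ (fun j => ?_) j
        · exact fun h => absurd rfl h
        · exact fun _ => by simpa using hya j
        · exact fun _ => by simpa using fun h => hya i (conjClass_symm h)
        · exact fun hij => by simpa using h2 i j fun h => hij (congrArg Fin.succ h)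
  obtain ⟨a, h1, h2⟩ := key (n + 1)
  have hind : ActionIndependent D (fun p : Σ _ : Fin (n + 1), Unit => a p.1) (fun _ => 1) :=
    actionIndependent_sigma (x := fun _ _ => 1) h2 fun j =>
      (LinearIndependent.of_subsingleton () one_ne_zero)
  have := hind.card_le hf fun k => by rw [← eval_eq_action, h1]
  simp at this

end OrePolynomial

/-! ### The equivalences -/

open OrePolynomial in
theorem theorem3p5 {K : Type u} [DivisionRing K] {S : K →+* K} (D : SkewDerivation S)
    (f : OrePolynomial D) (hf : f.Monic) :
    (∃ (r : ℕ) (a : Fin r → K), f.IsRootClassReps a) ∧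
    ∀ (r : ℕ) (a : Fin r → K), f.IsRootClassReps a →
      List.TFAE [
        f.Splits ∧ IsSemisimpleModule (OrePolynomial D)
          (OrePolynomial D ⧸ Submodule.span (OrePolynomial D) {f}),
        ∃ (P : (Matrix (Fin f.natDegree) (Fin f.natDegree) K)ˣ) (d : Fin f.natDegree → K),
          OrePolynomial.matrixConj D f.companion P = Matrix.diagonal d,
        ∃ c : Fin f.natDegree → K,
          IsUnit (OrePolynomial.vandermonde D c) ∧
          f.companion * OrePolynomial.vandermonde D c =
            (OrePolynomial.vandermonde D c).map S * Matrix.diagonal c +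
              (OrePolynomial.vandermonde D c).map D,
        (f.natDegree : Cardinal) =
          ∑ j, Module.rank (OrePolynomial.centralizer D (a j))ᵐᵒᵖ (f.expSpace (a j))] := by
  have hfm := hf.isMonicOfDegree
  refine ⟨hfm.exists_isRootClassReps, fun r a ha => ?_⟩
  obtain ⟨κ, _, p, x, hind, h0, hrank, hexp⟩ := hfm.exists_expSpace_bases ha.not_conj
  rw [hrank, Nat.cast_inj]
  tfae_have 1 → 4 := by
    rintro ⟨hs, hss⟩
    refine le_antisymm ?_ (hind.card_le hfm h0)
    let Q : Matrix (Fin f.natDegree) κ K :=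
      Matrix.of fun i k => (pseudo D (a (p k)))^[i] (x k)
    -- A row in the left kernel of `Q` is a polynomial of degree below `n` that vanishes at all
    -- roots of `f`, hence lies in `Rf` and is zero.
    have hinj : Function.Injective Q.vecMulLinear := by
      rw [← LinearMap.ker_eq_bot, LinearMap.ker_eq_bot']
      intro v hv
      let m : OrePolynomial D := ∑ i : Fin f.natDegree, monomial D i (v i)
      have hm (k : κ) : action m (a (p k)) (x k) = 0 := by
        rw [action_sum_left]
        simp only [action_monomial]
        exact congrFun hv k
      have hmf : m ∈ Submodule.span (OrePolynomial D) {f} := by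
        refine hs.mem_span_of_eval_eq_zero fun c hc => ?_
        obtain ⟨j, y, hy, rfl⟩ := ha.covers c hc
        rw [eval_conj_eq_zero_iff _ _ hy, ← mem_expSpace] at hc ⊢
        exact hexp m hm j hc
      have hm0 : m = 0 := by
        refine hfm.eq_zero_of_dvd (fun i hi => ?_) ?_
        · rw [coeff_sum]
          exact Finset.sum_eq_zero fun l _ => by
            rw [coeff_monomial, if_neg (by omega)]
        · obtain ⟨q, hq⟩ := Submodule.mem_span_singleton.1 hmf
          exact ⟨q, hq.symm⟩
      ext i
      have : m.coeff i = v i := by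
        rw [coeff_sum, Finset.sum_eq_single i]
        · rw [coeff_monomial, if_pos rfl]
        · exact fun l _ hl => by rw [coeff_monomial, if_neg fun h => hl (Fin.ext h)]
        · simp
      rw [← this, hm0]
      rfl
    simpa using LinearMap.finrank_le_finrank_of_injective hinj
  tfae_have 4 → 2 := by
    classical
    intro h
    let e : Fin f.natDegree ≃ κ := (Fintype.equivFinOfCardEq h.symm).symm
    obtain ⟨G, hG⟩ := (hind.comp_injective e.injective).exists_left_inverse hfm fun k => h0 (e k)
    -- For square matrices over a division ring a one-sided inverse is two-sided.
    refine ⟨⟨G, _, hG, mul_eq_one_symm hG⟩, fun k => a (p (e k)), ?_⟩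
    rw [matrixConj_eq_diagonal_iff, hf.companion_mul_eq_iff]
    exact fun k => ⟨x (e k), h0 (e k), fun i => rfl⟩
  tfae_have 2 → 3 := by
    rintro ⟨P, d, hP⟩
    rw [matrixConj_eq_diagonal_iff, hf.companion_mul_eq_iff] at hP
    choose x hx hQ using hP
    -- If `x k = 0`, the invertible matrix `P⁻¹` would have a zero column.
    have hx0 (k) : x k ≠ 0 := by
      intro h
      have h1 := congrFun (congrFun P.mul_inv k) k
      rw [Matrix.mul_apply, Finset.sum_eq_zero, Matrix.one_apply_eq] at h1
      · exact zero_ne_one h1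
      · intro i _
        rw [hQ, h, iterate_map_zero, mul_zero]
    refine ⟨fun k => conj D (d k) (x k), ?_, ?_⟩
    · have hV : vandermonde D (fun k => conj D (d k) (x k)) =
          (↑P⁻¹ : Matrix (Fin f.natDegree) (Fin f.natDegree) K) *
            Matrix.diagonal fun k => (x k)⁻¹ := by
        ext i k
        rw [Matrix.mul_diagonal, hQ, eq_mul_inv_iff_mul_eq₀ (hx0 k)]
        exact powerFn_conj_mul _ (hx0 k) i
      have hdiag : IsUnit (Matrix.diagonal fun k => (x k)⁻¹) :=
        IsUnit.of_mul_eq_one (Matrix.diagonal x) <| by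
          rw [Matrix.diagonal_mul_diagonal]
          simp [hx0]
      rw [hV]
      exact (P⁻¹).isUnit.mul hdiag
    · rw [hf.companion_mul_eq_iff]
      refine fun k => ⟨1, ?_, fun i => powerFn_eq_iterate _ _⟩
      rw [← eval_eq_action, eval_conj_eq_zero_iff _ _ (hx0 k), hx]
  tfae_have 3 → 1 := by
    rintro ⟨c, hV, hc⟩
    have hroot (k) : eval f (c k) = 0 := by
      obtain ⟨y, hy, hi⟩ := (hf.companion_mul_eq_iff _ _).1 hc k
      -- The top row of a Vandermonde matrix is constantly `N₀ = 1`.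
      have hy1 : y = 1 := (hi ⟨0, k.pos⟩).symm
      rw [eval_eq_action, ← hy1, hy]
    have hmem (g : OrePolynomial D) :
        g ∈ Submodule.span (OrePolynomial D) {f} ↔ ∀ k, eval g (c k) = 0 := by
      rw [Submodule.mem_span_singleton]
      constructor
      · rintro ⟨q, rfl⟩ k
        rw [smul_eq_mul, eval_eq_action, action_mul, ← eval_eq_action, hroot, action_zero_right]
      · intro hg
        obtain ⟨q, hq⟩ := hfm.exists_div g
        refine ⟨q, ?_⟩
        -- The remainder of `g` vanishes at every `c k`, so its coefficient row is killed by the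
        -- invertible `V`.
        have h1 : Matrix.vecMul (fun i : Fin f.natDegree => (g - q * f).coeff i)
            (vandermonde D c) = 0 := by
          ext k
          have h2 := action_of_coeff_eq_zero _ hq (c k) 1
          rw [action_sub_left, action_mul, ← eval_eq_action g, ← eval_eq_action f, hg, hroot,
            action_zero_right, sub_zero] at h2
          simp only [← powerFn_eq_iterate] at h2
          exact h2.symm
        obtain ⟨U, hU⟩ := hV
        have h2 : (fun i : Fin f.natDegree => (g - q * f).coeff i) = 0 := by
          have h3 := congrArg (fun v => Matrix.vecMul v
            (↑U⁻¹ : Matrix (Fin f.natDegree) (Fin f.natDegree) K)) h1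
          simpa [Matrix.vecMul_vecMul, ← hU] using h3
        rw [eq_comm, ← sub_eq_zero]
        refine ext fun i => ?_
        by_cases hi : i < f.natDegree
        · exact congrFun h2 ⟨i, hi⟩
        · exact hq i (not_lt.1 hi)
    exact ⟨hfm.splits_of_mem_span_iff c hmem, isSemisimpleModule_of_mem_span_iff c hmem⟩
  tfae_finish
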